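/- Let $\hat M, M\subseteq\mathbb R^4$ be open sets (spacetimes described by global coordinates) and let $\varphi:\hat M\to M$ be an orientation-preserving $C^\infty$ diffeomorphism, i.e. $\det D\varphi>0$ on $\hat M$. Write $(x,y)=(x^0,\dots,x^3,y^0,\dots,y^3)$ for the coordinates on $M\times M$, oriented by $dx^0\wedge\dots\wedge dx^3\wedge dy^0\wedge\dots\wedge dy^3$, and let $\varphi_{XY}=\varphi\times\varphi:\hat M\times\hat M\to M\times M$. Let $$\Delta=\tfrac14\sum_{a,b,c,d=0}^{3}\epsilon_{abcd}\,\delta^{(4)}(x-y)\,dx^a\wedge dx^b\wedge dy^c\wedge dy^d$$ be the distributional $4$-form on $M\times M$, where $\epsilon_{abcd}$ is the Levi-Civita symbol and $\delta^{(4)}(x-y)$ is the distribution $\psi\mapsto\int_M\psi(x,x)\,d^4x$. It acts on smooth compactly supported test $4$-forms $\alpha$ by $\alpha\mapsto\int_{M\times M}\alpha\wedge\Delta$. Let $\hat\Delta$ be the distributional $4$-form on $\hat M\times\hat M$ given by the same formula in the coordinates of $\hat M\times\hat M$. For a distributional $4$-form $T$ on $M\times M$, its pullback $\varphi_{XY}^*T$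 is defined by $\int_{\hat M\times\hat M}\beta\wedge\varphi_{XY}^*T=\int_{M\times M}\bigl((\varphi_{XY}^{-1})^*\beta\bigr)\wedge T$ for all test $4$-forms $\beta$ on $\hat M\times\hat M$. Then $$\varphi_{XY}^*\Delta=\hat\Delta .$$ -/

import Mathlib

open Set TopologicalSpace MeasureTheory
open scoped ContDiff Distributions

noncomputable section

namespace DeltaForm

/-! ### Diffeomorphisms between open sets -/

section Diffeo

variable {E : Type*} [NormedAddCommGroup E] [NormedSpace ℝ E]

/-- A smooth diffeomorphism from the open set `V` onto the open set `U`. -/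
structure Diffeo (V U : Opens E) where
  toHomeo : OpenPartialHomeomorph E E
  source_eq : toHomeo.source = V
  target_eq : toHomeo.target = U
  smooth : ContDiffOn ℝ ∞ toHomeo V
  smooth_symm : ContDiffOn ℝ ∞ toHomeo.symm U

namespace Diffeo

/-- The inverse diffeomorphism. -/
def symm {V U : Opens E} (φ : Diffeo V U) : Diffeo U V where
  toHomeo := φ.toHomeo.symm
  source_eq := φ.target_eq
  target_eq := φ.source_eq
  smooth := φ.smooth_symm
  smooth_symm := φ.smooth

/-- `φ` preserves orientation: its Jacobian determinant is positive at every point. -/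
def OrientationPreserving {V U : Opens E} (φ : Diffeo V U) : Prop :=
  ∀ x ∈ V, 0 < (fderiv ℝ φ.toHomeo x).det

theorem mapsTo {V U : Opens E} (φ : Diffeo V U) : MapsTo φ.toHomeo V U := by
  intro x hx
  have h := φ.toHomeo.map_source (x := x) (by rw [φ.source_eq]; exact hx)
  rw [φ.target_eq] at h
  exact h

theorem left_inv {V U : Opens E} (φ : Diffeo V U) {x : E} (hx : x ∈ V) :
    φ.symm.toHomeo (φ.toHomeo x) = x :=
  φ.toHomeo.left_inv (by rw [φ.source_eq]; exact hx)

theorem differentiableAt {V U : Opens E} (φ : Diffeo V U) {x : E} (hx : x ∈ V) :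
    DifferentiableAt ℝ φ.toHomeo x :=
  (φ.smooth.contDiffAt (V.isOpen.mem_nhds hx)).differentiableAt (by simp)

theorem det_ne_zero {V U : Opens E} (φ : Diffeo V U) {x : E} (hx : x ∈ V) :
    (fderiv ℝ φ.toHomeo x).det ≠ 0 := by
  have h1 : HasFDerivAt (φ.symm.toHomeo ∘ φ.toHomeo)
      ((fderiv ℝ φ.symm.toHomeo (φ.toHomeo x)).comp (fderiv ℝ φ.toHomeo x)) x :=
    (φ.symm.differentiableAt (φ.mapsTo hx)).hasFDerivAt.comp x (φ.differentiableAt hx).hasFDerivAt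
  have h2 : HasFDerivAt (φ.symm.toHomeo ∘ φ.toHomeo) (ContinuousLinearMap.id ℝ E) x := by
    refine (hasFDerivAt_id x).congr_of_eventuallyEq ?_
    filter_upwards [V.isOpen.mem_nhds hx] with y hy using φ.left_inv hy
  have h3 := congrArg ContinuousLinearMap.det (h1.unique h2)
  intro h0
  have h4 : ((fderiv ℝ φ.symm.toHomeo (φ.toHomeo x)).comp (fderiv ℝ φ.toHomeo x)).det =
      (fderiv ℝ φ.symm.toHomeo (φ.toHomeo x)).det * (fderiv ℝ φ.toHomeo x).det :=
    LinearMap.det_comp _ _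
  rw [h4, h0, mul_zero] at h3
  have h5 : (ContinuousLinearMap.id ℝ E).det = 1 := LinearMap.det_id
  rw [h5] at h3
  exact zero_ne_one h3

end Diffeo

end Diffeo

/-- The product of two open sets, as an open set. -/
def prodOpens {E F : Type*} [TopologicalSpace E] [TopologicalSpace F]
    (U : Opens E) (V : Opens F) : Opens (E × F) :=
  ⟨(U : Set E) ×ˢ (V : Set F), U.isOpen.prod V.isOpen⟩

/-- The product diffeomorphism `φ × ψ : (x, y) ↦ (φ x, ψ y)`. -/
def Diffeo.prod {E F : Type*} [NormedAddCommGroup E] [NormedSpace ℝ E]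
    [NormedAddCommGroup F] [NormedSpace ℝ F] {V U : Opens E} {V' U' : Opens F}
    (φ : Diffeo V U) (ψ : Diffeo V' U') : Diffeo (prodOpens V V') (prodOpens U U') where
  toHomeo := φ.toHomeo.prod ψ.toHomeo
  source_eq := by
    rw [OpenPartialHomeomorph.prod_source, φ.source_eq, ψ.source_eq]; rfl
  target_eq := by
    rw [OpenPartialHomeomorph.prod_target, φ.target_eq, ψ.target_eq]; rfl
  smooth := φ.smooth.prodMap ψ.smooth
  smooth_symm := φ.smooth_symm.prodMap ψ.smooth_symm

/-! ### Test forms, distributional forms and their pullback -/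

section Forms

variable {E : Type*} [NormedAddCommGroup E] [NormedSpace ℝ E]

/-- Test `k`-forms on `U`: smooth `k`-forms with compact support contained in `U`. -/
abbrev TestForm (U : Opens E) (k : ℕ) : Type _ := 𝓓(U, E [⋀^Fin k]→L[ℝ] ℝ)

/-- Distributional forms `T` on `U ⊆ E`, given by their (continuous) action
`α ↦ ∫_U α ∧ T` on test `k`-forms. Here `k` is the complementary degree:
the degree of `T` is `dim E - k`. -/
abbrev FormDistribution (U : Opens E) (k : ℕ) : Type _ := TestForm U k →L[ℝ] ℝ

/-- Antisymmetrization, as a continuous linear map. -/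
def altCLM (k : ℕ) :
    ContinuousMultilinearMap ℝ (fun _ : Fin k => E) ℝ →L[ℝ] E [⋀^Fin k]→L[ℝ] ℝ :=
  LinearMap.mkContinuous
    { toFun := fun f => ContinuousMultilinearMap.alternatization f
      map_add' := fun f g => map_add _ f g
      map_smul' := fun c f => by
        ext v
        simp [ContinuousMultilinearMap.alternatization_apply_apply, Finset.mul_sum,
          mul_smul_comm] } (Fintype.card (Equiv.Perm (Fin k))) (by
    intro f
    refine ContinuousAlternatingMap.opNorm_le_bound _ ?_ ?_
    · positivity
    intro v
    simp only [LinearMap.coe_mk, AddHom.coe_mk,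
      ContinuousMultilinearMap.alternatization_apply_apply]
    refine (norm_sum_le _ _).trans ?_
    rw [mul_assoc, ← nsmul_eq_mul, ← Finset.card_univ]
    refine Finset.sum_le_card_nsmul _ _ _ ?_
    intro σ _
    have h1 : ‖Equiv.Perm.sign σ • f (v ∘ σ)‖ = ‖f (v ∘ σ)‖ := by
      rcases Int.units_eq_one_or (Equiv.Perm.sign σ) with h | h <;> simp [h]
    rw [h1]
    refine (f.le_opNorm _).trans (le_of_eq ?_)
    congr 1
    exact Equiv.prod_comp σ (fun i => ‖v i‖))

theorem altCLM_apply_alternating {k : ℕ} (f : E [⋀^Fin k]→L[ℝ] ℝ) :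
    altCLM k f.toContinuousMultilinearMap = (Fintype.card (Equiv.Perm (Fin k)) : ℝ) • f := by
  ext v
  change ContinuousMultilinearMap.alternatization f.toContinuousMultilinearMap v = _
  rw [ContinuousMultilinearMap.alternatization_apply_apply]
  have h : ∀ σ : Equiv.Perm (Fin k),
      Equiv.Perm.sign σ • f.toContinuousMultilinearMap (v ∘ σ) = f v := by
    intro σ
    have h1 : f (v ∘ σ) = Equiv.Perm.sign σ • f v := f.toAlternatingMap.map_perm v σ
    change Equiv.Perm.sign σ • f (v ∘ σ) = f v
    rw [h1, smul_smul, Int.units_mul_self, one_smul]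
  rw [Finset.sum_congr rfl fun σ _ => h σ]
  simp

theorem contDiff_compCLM (k : ℕ) :
    ContDiff ℝ ∞ (fun A : E →L[ℝ] E =>
      (ContinuousAlternatingMap.compContinuousLinearMapCLM A :
        (E [⋀^Fin k]→L[ℝ] ℝ) →L[ℝ] (E [⋀^Fin k]→L[ℝ] ℝ))) := by
  let m := ContinuousMultilinearMap.compContinuousLinearMapContinuousMultilinear ℝ
    (fun _ : Fin k => E) (fun _ : Fin k => E) ℝ
  let ι : (E [⋀^Fin k]→L[ℝ] ℝ) →L[ℝ] ContinuousMultilinearMap ℝ (fun _ : Fin k => E) ℝ :=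
    ContinuousAlternatingMap.toContinuousMultilinearMapCLM ℝ
  let c : ℝ := (Fintype.card (Equiv.Perm (Fin k)) : ℝ)
  have hc : c ≠ 0 := Nat.cast_ne_zero.2 Fintype.card_ne_zero
  have heq : (fun A : E →L[ℝ] E =>
      (ContinuousAlternatingMap.compContinuousLinearMapCLM A :
        (E [⋀^Fin k]→L[ℝ] ℝ) →L[ℝ] (E [⋀^Fin k]→L[ℝ] ℝ))) =
      fun A => c⁻¹ • ((altCLM k).comp ((m fun _ => A).comp ι)) := by
    funext A
    refine ContinuousLinearMap.ext fun f => ?_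
    have h1 : (m fun _ => A) (ι f) = (f.compContinuousLinearMap A).toContinuousMultilinearMap := by
      ext v; rfl
    change f.compContinuousLinearMap A = c⁻¹ • altCLM k ((m fun _ => A) (ι f))
    rw [h1, altCLM_apply_alternating, smul_smul, inv_mul_cancel₀ hc, one_smul]
  rw [heq]
  have hm0 : ContDiff ℝ ∞ m :=
    ContinuousMultilinearMap.contDiff (𝕜 := ℝ) (E := fun _ : Fin k => E →L[ℝ] E)
      (F := ContinuousMultilinearMap ℝ (fun _ : Fin k => E) ℝ →L[ℝ]
        ContinuousMultilinearMap ℝ (fun _ : Fin k => E) ℝ) m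
  have hm : ContDiff ℝ ∞ (fun A : E →L[ℝ] E => m fun _ : Fin k => A) :=
    hm0.comp (f := fun (A : E →L[ℝ] E) (_ : Fin k) => A) (contDiff_pi.2 fun _ => contDiff_id)
  exact (contDiff_const.clm_comp (hm.clm_comp contDiff_const)).const_smul c⁻¹

theorem contDiffOn_smul' {G : Type*} [NormedAddCommGroup G] [NormedSpace ℝ G] {s : E → ℝ}
    {g : E → G} {V : Set E} (hs : ContDiffOn ℝ ∞ s V) (hg : ContDiffOn ℝ ∞ g V) :
    ContDiffOn ℝ ∞ (fun x => s x • g x) V := hs.smul hg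

/-- The sign `±1` of the Jacobian determinant of `φ` at `x`. -/
def Diffeo.detSign {V U : Opens E} (φ : Diffeo V U) (x : E) : ℝ :=
  (SignType.sign (fderiv ℝ φ.toHomeo x).det : ℝ)

/-- The linear map on `k`-covectors underlying the pullback of `k`-forms along `φ` at `x`,
multiplied by the sign of the Jacobian determinant. -/
def Diffeo.pullCoeff {V U : Opens E} (φ : Diffeo V U) (k : ℕ) (x : E) :
    (E [⋀^Fin k]→L[ℝ] ℝ) →L[ℝ] (E [⋀^Fin k]→L[ℝ] ℝ) :=
  φ.detSign x • ContinuousAlternatingMap.compContinuousLinearMapCLM (fderiv ℝ φ.toHomeo x)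

theorem Diffeo.contDiffOn_pullCoeff [FiniteDimensional ℝ E] {V U : Opens E} (φ : Diffeo V U)
    (k : ℕ) : ContDiffOn ℝ ∞ (φ.pullCoeff k) V := by
  have hd : ContDiffOn ℝ ∞ (fderiv ℝ φ.toHomeo) V :=
    φ.smooth.fderiv_of_isOpen V.isOpen (by simp)
  have hs : ContDiffOn ℝ ∞ φ.detSign V := by
    intro x hx
    refine ContDiffAt.contDiffWithinAt ?_
    have hcont : ContinuousAt (fun y => SignType.sign (fderiv ℝ φ.toHomeo y).det) x := by
      have h1 : ContinuousAt (fun y => (fderiv ℝ φ.toHomeo y).det) x :=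
        ContinuousLinearMap.continuous_det.continuousAt.comp
          (hd.continuousOn.continuousAt (V.isOpen.mem_nhds hx))
      exact (continuousAt_sign_of_ne_zero (φ.det_ne_zero hx)).comp
        (f := fun y => (fderiv ℝ φ.toHomeo y).det) h1
    have hev : ∀ᶠ y in nhds x, SignType.sign (fderiv ℝ φ.toHomeo y).det =
        SignType.sign (fderiv ℝ φ.toHomeo x).det :=
      hcont.eventually_mem (isOpen_discrete {_}|>.mem_nhds rfl)
    refine contDiffAt_const (c := φ.detSign x) |>.congr_of_eventuallyEq ?_
    filter_upwards [hev] with y hy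
    simp only [Diffeo.detSign, hy]
  exact contDiffOn_smul' hs ((contDiff_compCLM k).comp_contDiffOn hd)

/-- The function underlying the transport of test functions along `φ`. -/
def transportFun {F F' : Type*} [NormedAddCommGroup F] [NormedSpace ℝ F]
    [NormedAddCommGroup F'] [NormedSpace ℝ F'] {V U : Opens E} (φ : Diffeo V U)
    (G : E → F →L[ℝ] F') (f : E → F) : E → F' :=
  (V : Set E).indicator fun x => G x (f (φ.toHomeo x))

section Transport

variable {F F' : Type*} [NormedAddCommGroup F] [NormedSpace ℝ F]
    [NormedAddCommGroup F'] [NormedSpace ℝ F'] {V U : Opens E}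

theorem image_symm_subset (φ : Diffeo V U) {K : Set E} (hK : K ⊆ U) :
    φ.symm.toHomeo '' K ⊆ V := by
  rintro _ ⟨y, hy, rfl⟩
  exact φ.symm.mapsTo (hK hy)

theorem isCompact_image_symm (φ : Diffeo V U) {K : Set E} (hK : IsCompact K) (hKU : K ⊆ U) :
    IsCompact (φ.symm.toHomeo '' K) :=
  hK.image_of_continuousOn (φ.symm.smooth.continuousOn.mono hKU)

theorem transportFun_zero (φ : Diffeo V U) (G : E → F →L[ℝ] F') {f : E → F} {K : Set E}
    (hf : EqOn f 0 Kᶜ) :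
    EqOn (transportFun φ G f) 0 (φ.symm.toHomeo '' K)ᶜ := by
  intro x hx
  by_cases hxV : x ∈ (V : Set E)
  · have h1 : φ.toHomeo x ∈ Kᶜ := fun h => hx ⟨_, h, φ.left_inv hxV⟩
    have h2 : f (φ.toHomeo x) = 0 := hf h1
    simp only [transportFun, indicator_of_mem hxV, h2, map_zero, Pi.zero_apply]
  · simp only [transportFun, indicator_of_notMem hxV, Pi.zero_apply]

theorem contDiffOn_transport (φ : Diffeo V U) {G : E → F →L[ℝ] F'} (hG : ContDiffOn ℝ ∞ G V)
    {f : E → F} (hf : ContDiff ℝ ∞ f) :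
    ContDiffOn ℝ ∞ (fun x => G x (f (φ.toHomeo x))) V :=
  hG.clm_apply (hf.comp_contDiffOn φ.smooth)

theorem contDiff_transportFun (φ : Diffeo V U) {G : E → F →L[ℝ] F'} (hG : ContDiffOn ℝ ∞ G V)
    {f : E → F} (hf : ContDiff ℝ ∞ f) {K : Set E} (hK : IsCompact K) (hKU : K ⊆ U)
    (hfK : EqOn f 0 Kᶜ) : ContDiff ℝ ∞ (transportFun φ G f) := by
  rw [contDiff_iff_contDiffAt]
  intro x
  by_cases hxV : x ∈ (V : Set E)
  · refine ((contDiffOn_transport φ hG hf).contDiffAt (V.isOpen.mem_nhds hxV)).congr_of_eventuallyEq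
      ?_
    filter_upwards [V.isOpen.mem_nhds hxV] with y hy
    simp only [transportFun, indicator_of_mem hy]
  · have hx : x ∈ (φ.symm.toHomeo '' K)ᶜ := fun h => hxV (image_symm_subset φ hKU h)
    refine (contDiffAt_const (c := (0 : F'))).congr_of_eventuallyEq ?_
    filter_upwards [(isCompact_image_symm φ hK hKU).isClosed.isOpen_compl.mem_nhds hx] with y hy
    exact transportFun_zero φ G hfK hy

theorem exists_bound_iteratedFDerivWithin {F : Type*} [NormedAddCommGroup F] [NormedSpace ℝ F]
    {g : E → F} (hg : ContDiffOn ℝ ∞ g V) {L : Set E} (hL : IsCompact L) (hLV : L ⊆ V) (n : ℕ) :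
    ∃ C : ℝ, 1 ≤ C ∧ ∀ i ≤ n, ∀ x ∈ L, ‖iteratedFDerivWithin ℝ i g V x‖ ≤ C := by
  have h : ∀ i : ℕ, ∃ C : ℝ, ∀ x ∈ L, ‖iteratedFDerivWithin ℝ i g V x‖ ≤ C := fun i =>
    hL.exists_bound_of_continuousOn
      ((hg.continuousOn_iteratedFDerivWithin (m := i) (by exact_mod_cast le_top)
        V.isOpen.uniqueDiffOn).mono hLV)
  choose C hC using h
  refine ⟨1 + ∑ i ∈ Finset.range (n + 1), |C i|, ?_, fun i hi x hx => (hC i x hx).trans ?_⟩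
  · have := Finset.sum_nonneg (s := Finset.range (n + 1)) fun i _ => abs_nonneg (C i)
    linarith
  · have := Finset.single_le_sum (f := fun i => |C i|) (fun i _ => abs_nonneg (C i))
      (Finset.mem_range_succ_iff.2 hi)
    have h2 := le_abs_self (C i)
    linarith

theorem transport_bound (φ : Diffeo V U) {G : E → F →L[ℝ] F'} (hG : ContDiffOn ℝ ∞ G V)
    {L : Set E} (hL : IsCompact L) (hLV : L ⊆ V) (n : ℕ) :
    ∃ C : ℝ, 0 ≤ C ∧ ∀ f : E → F, ContDiff ℝ ∞ f → ∀ x ∈ L, ∀ S : ℝ,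
      (∀ i ≤ n, ‖iteratedFDeriv ℝ i f (φ.toHomeo x)‖ ≤ S) →
      ‖iteratedFDeriv ℝ n (transportFun φ G f) x‖ ≤ C * S := by
  obtain ⟨A, hA1, hA⟩ := exists_bound_iteratedFDerivWithin hG hL hLV n
  obtain ⟨B, hB1, hB⟩ := exists_bound_iteratedFDerivWithin φ.smooth hL hLV n
  refine ⟨∑ i ∈ Finset.range (n + 1), (n.choose i : ℝ) * A * ((n - i).factorial * B ^ (n - i)),
    by positivity, fun f hf x hx S hS => ?_⟩
  have hxV : x ∈ (V : Set E) := hLV hx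
  have h1 : iteratedFDeriv ℝ n (transportFun φ G f) x =
      iteratedFDerivWithin ℝ n (fun x => G x (f (φ.toHomeo x))) V x := by
    rw [← iteratedFDerivWithin_of_isOpen n V.isOpen hxV]
    refine iteratedFDerivWithin_congr ?_ hxV n
    intro y hy
    simp only [transportFun, indicator_of_mem hy]
  rw [h1]
  refine (norm_iteratedFDerivWithin_clm_apply (N := ∞) hG (hf.comp_contDiffOn φ.smooth)
    V.isOpen.uniqueDiffOn hxV (by exact_mod_cast le_top)).trans ?_
  rw [Finset.sum_mul]
  refine Finset.sum_le_sum fun i hi => ?_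
  have hi' := Finset.mem_range_succ_iff.1 hi
  have h2 : ‖iteratedFDerivWithin ℝ (n - i) (f ∘ φ.toHomeo) V x‖ ≤
      (n - i).factorial * S * B ^ (n - i) := by
    refine norm_iteratedFDerivWithin_comp_le (t := univ) (N := ∞) hf.contDiffOn φ.smooth
      (WithTop.coe_le_coe.2 le_top) uniqueDiffOn_univ V.isOpen.uniqueDiffOn (mapsTo_univ _ _) hxV ?_ ?_
    · intro j hj
      rw [iteratedFDerivWithin_univ]
      exact hS j (hj.trans (Nat.sub_le _ _))
    · intro j hj hj'
      exact (hB j (hj'.trans (Nat.sub_le _ _)) x hx).trans (le_self_pow₀ hB1 (by omega))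
  calc (n.choose i : ℝ) * ‖iteratedFDerivWithin ℝ i G V x‖ *
        ‖iteratedFDerivWithin ℝ (n - i) (f ∘ φ.toHomeo) V x‖
      ≤ (n.choose i : ℝ) * A * ((n - i).factorial * S * B ^ (n - i)) := by
        gcongr
        exact hA i hi' x hx
    _ = (n.choose i : ℝ) * A * ((n - i).factorial * B ^ (n - i)) * S := by ring

/-- The transport map on test functions with support in a fixed compact set. -/
def transportK (φ : Diffeo V U) {G : E → F →L[ℝ] F'} (hG : ContDiffOn ℝ ∞ G V)
    (K : Compacts E) (hK : (K : Set E) ⊆ U) :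
    𝓓_{K}(E, F) →L[ℝ]
      𝓓_{(⟨φ.symm.toHomeo '' K, isCompact_image_symm φ K.isCompact hK⟩ : Compacts E)}(E, F') :=
  ContDiffMapSupportedIn.mkCLM ℝ (fun f => transportFun φ G f)
    (fun f g x => by
      by_cases hx : x ∈ (V : Set E) <;> simp [transportFun, hx])
    (fun c f x => by
      by_cases hx : x ∈ (V : Set E) <;> simp [transportFun, hx])
    (fun f => contDiff_transportFun φ hG f.contDiff K.isCompact hK f.zero_on_compl)
    (fun f => transportFun_zero φ G f.zero_on_compl)
    (fun n _ => by
      obtain ⟨C, hC0, hC⟩ := transport_bound φ hG (isCompact_image_symm φ K.isCompact hK)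
        (image_symm_subset φ hK) n
      refine ⟨Finset.Iic n, C, hC0, fun f x hx => hC f f.contDiff x hx _ fun i hi => ?_⟩
      exact (ContDiffMapSupportedIn.norm_iteratedFDeriv_apply_le_seminorm_top ℝ).trans
        (Seminorm.le_finset_sup_apply (Finset.mem_Iic.2 hi)))

/-- The continuous linear map `f ↦ (x ↦ G x (f (φ x)))` on test functions. -/
def transport (φ : Diffeo V U) {G : E → F →L[ℝ] F'} (hG : ContDiffOn ℝ ∞ G V) :
    𝓓(U, F) →L[ℝ] 𝓓(V, F') :=
  TestFunction.limitCLM ℝ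
    (fun f => ⟨transportFun φ G f,
      contDiff_transportFun φ hG f.contDiff f.hasCompactSupport f.tsupport_subset
        (fun _ hx => image_eq_zero_of_notMem_tsupport hx),
      HasCompactSupport.intro (isCompact_image_symm φ f.hasCompactSupport f.tsupport_subset)
        (fun _ hx => transportFun_zero φ G
          (fun _ hx => image_eq_zero_of_notMem_tsupport hx) hx),
      (closure_minimal
        (fun x hx => by
          by_contra h
          exact hx (transportFun_zero φ G
            (fun _ hx => image_eq_zero_of_notMem_tsupport hx) h))
        (isCompact_image_symm φ f.hasCompactSupport f.tsupport_subset).isClosed).trans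
        (image_symm_subset φ f.tsupport_subset)⟩)
    (fun K hK => (TestFunction.ofSupportedInCLM ℝ (image_symm_subset φ hK)).comp
      (transportK φ hG K hK))
    (fun K hK f => by ext x; rfl)

end Transport

/-- The signed pullback of test forms along a diffeomorphism,
`(β ↦ sign (det Dφ) • φ^* β)`; for an orientation preserving `φ` it is just `φ^* β`. -/
def Diffeo.signedPullback [FiniteDimensional ℝ E] {V U : Opens E} (φ : Diffeo V U) (k : ℕ) :
    TestForm U k →L[ℝ] TestForm V k :=
  transport φ (φ.contDiffOn_pullCoeff k)

/-- The pullback `φ^* T` of a distributional form `T` along a diffeomorphism `φ : V → U`, determined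
by `∫_V β ∧ φ^* T = ∫_U ((φ⁻¹)^* β) ∧ T` when `φ` preserves orientation, and by
`∫_V β ∧ φ^* T = ∫_U sign (det D(φ⁻¹)) ((φ⁻¹)^* β) ∧ T` in general (change of variables). -/
def Diffeo.pullback [FiniteDimensional ℝ E] {V U : Opens E} (φ : Diffeo V U) {k : ℕ}
    (T : FormDistribution U k) : FormDistribution V k :=
  T.comp (φ.symm.signedPullback k)

theorem Diffeo.signedPullback_apply [FiniteDimensional ℝ E] {V U : Opens E} (φ : Diffeo V U)
    {k : ℕ} (β : TestForm U k) {x : E} (hx : x ∈ V) :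
    φ.signedPullback k β x =
      φ.detSign x • (β (φ.toHomeo x)).compContinuousLinearMap (fderiv ℝ φ.toHomeo x) := by
  have hx' : x ∈ (V : Set E) := hx
  change transportFun φ (φ.pullCoeff k) β x = _
  simp only [transportFun, indicator_of_mem hx']
  rfl

theorem Diffeo.pullback_apply [FiniteDimensional ℝ E] {V U : Opens E} (φ : Diffeo V U) {k : ℕ}
    (T : FormDistribution U k) (β : TestForm V k) :
    φ.pullback T β = T (φ.symm.signedPullback k β) := rfl

/-- The wedge product of alternating forms (sum over shuffles). -/
def wedge {p q : ℕ} (α : E [⋀^Fin p]→L[ℝ] ℝ) (η : E [⋀^Fin q]→L[ℝ] ℝ) :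
    E [⋀^Fin p ⊕ Fin q]→ₗ[ℝ] ℝ :=
  (LinearMap.mul' ℝ ℝ).compAlternatingMap (α.toAlternatingMap.domCoprod η.toAlternatingMap)

theorem wedge_apply {p q : ℕ} (α : E [⋀^Fin p]→L[ℝ] ℝ) (η : E [⋀^Fin q]→L[ℝ] ℝ)
    (v : Fin p ⊕ Fin q → E) :
    wedge α η v = ∑ σ : Equiv.Perm.ModSumCongr (Fin p) (Fin q),
      LinearMap.mul' ℝ ℝ
        (AlternatingMap.domCoprod.summand α.toAlternatingMap η.toAlternatingMap σ v) := by
  simp only [wedge, LinearMap.compAlternatingMap_apply, AlternatingMap.domCoprod_apply,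
    sum_apply, map_sum]

theorem mul_summand {p q : ℕ} (α : E [⋀^Fin p]→L[ℝ] ℝ) (η : E [⋀^Fin q]→L[ℝ] ℝ)
    (v : Fin p ⊕ Fin q → E) (σ : Equiv.Perm (Fin p ⊕ Fin q)) :
    LinearMap.mul' ℝ ℝ (AlternatingMap.domCoprod.summand α.toAlternatingMap
        η.toAlternatingMap (Quotient.mk'' σ) v) =
      ((Equiv.Perm.sign σ : ℤ) : ℝ) *
        (α (fun i => v (σ (Sum.inl i))) * η (fun i => v (σ (Sum.inr i)))) := by
  rw [AlternatingMap.domCoprod.summand_mk'']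
  rcases Int.units_eq_one_or (Equiv.Perm.sign σ) with h | h <;> simp [h]

/-- The linear form `α ↦ (α ∧ η) (v)`. -/
def wedgeEval {p q : ℕ} (η : E [⋀^Fin q]→L[ℝ] ℝ) (v : Fin p ⊕ Fin q → E) :
    (E [⋀^Fin p]→L[ℝ] ℝ) →L[ℝ] ℝ where
  toFun α := wedge α η v
  map_add' α β := by
    simp only [wedge_apply, ← Finset.sum_add_distrib]
    refine Finset.sum_congr rfl fun σ _ => ?_
    induction σ using Quotient.inductionOn' with
    | h σ => simp only [mul_summand, ContinuousAlternatingMap.add_apply]; ring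
  map_smul' c α := by
    simp only [wedge_apply, RingHom.id_apply, smul_eq_mul, Finset.mul_sum]
    refine Finset.sum_congr rfl fun σ _ => ?_
    induction σ using Quotient.inductionOn' with
    | h σ => simp only [mul_summand, ContinuousAlternatingMap.smul_apply, smul_eq_mul]; ring
  cont := by
    simp only [wedge_apply]
    refine continuous_finsetSum _ fun σ _ => ?_
    induction σ using Quotient.inductionOn' with
    | h σ =>
      simp only [mul_summand]
      exact continuous_const.mul ((continuous_eval_const _).mul continuous_const)

/-- The wedge product `ℓ 0 ∧ ℓ 1 ∧ ⋯ ∧ ℓ (k - 1)` of covectors. -/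
def covectorWedge {k : ℕ} (ℓ : Fin k → (E →L[ℝ] ℝ)) : E [⋀^Fin k]→L[ℝ] ℝ :=
  { (Matrix.detRowAlternating (n := Fin k) (R := ℝ)).compLinearMap
      (LinearMap.pi fun i => (ℓ i : E →ₗ[ℝ] ℝ)) with
    cont := by
      change Continuous fun v : Fin k → E => Matrix.det (Matrix.of fun i j => ℓ j (v i))
      fun_prop }

theorem covectorWedge_apply {k : ℕ} (ℓ : Fin k → (E →L[ℝ] ℝ)) (v : Fin k → E) :
    covectorWedge ℓ v = Matrix.det (Matrix.of fun i j => ℓ j (v i)) := rfl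

/-- The functional `α ↦ u (T ∘ α)` on vector valued test functions, for a scalar distribution `u`
and a linear form `T` on the space of values. -/
def pairWith {F : Type*} [NormedAddCommGroup F] [NormedSpace ℝ F] {W : Opens E} (u : 𝓓'(W, ℝ))
    (T : F →L[ℝ] ℝ) : 𝓓(W, F) →L[ℝ] ℝ where
  toFun α := u (TestFunction.postcompCLM T α)
  map_add' α β := by rw [map_add, map_add]
  map_smul' c α := by rw [map_smul, map_smul]; rfl
  cont := (map_continuous u).comp (TestFunction.postcompCLM T).continuous

theorem pairWith_apply {F : Type*} [NormedAddCommGroup F] [NormedSpace ℝ F] {W : Opens E}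
    (u : 𝓓'(W, ℝ)) (T : F →L[ℝ] ℝ) (α : 𝓓(W, F)) :
    pairWith u T α = u (TestFunction.postcompCLM T α) := rfl

end Forms

/-! ### The diagonal delta form on the product of two copies of spacetime -/

/-- Spacetime coordinates `(x⁰, x¹, x², x³)`. -/
abbrev R4 : Type := Fin 4 → ℝ

/-- The one-form `dxᵃ` on `R4 × R4`. -/
def dx (a : Fin 4) : R4 × R4 →L[ℝ] ℝ :=
  (ContinuousLinearMap.proj a).comp (ContinuousLinearMap.fst ℝ R4 R4)

/-- The one-form `dyᵃ` on `R4 × R4`. -/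
def dy (a : Fin 4) : R4 × R4 →L[ℝ] ℝ :=
  (ContinuousLinearMap.proj a).comp (ContinuousLinearMap.snd ℝ R4 R4)

/-- The Levi-Civita symbol `ε_{abcd}`: the sign of `(a, b, c, d)` if it is a permutation of
`(0, 1, 2, 3)`, and `0` otherwise. -/
def leviCivita (a b c d : Fin 4) : ℝ :=
  Matrix.det (Matrix.of fun i j : Fin 4 => if ![a, b, c, d] i = j then (1 : ℝ) else 0)

/-- The coordinate frame `∂/∂x⁰, …, ∂/∂x³, ∂/∂y⁰, …, ∂/∂y³` of `R4 × R4`. -/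
def frame : Fin 4 ⊕ Fin 4 → R4 × R4 :=
  Sum.elim (fun i => (Pi.single i 1, 0)) (fun i => (0, Pi.single i 1))

theorem integrable_diag {U : Opens R4} (f : R4 × R4 → ℝ) (hf : Continuous f)
    (hs : HasCompactSupport f) : Integrable (fun x : R4 => f (x, x)) (volume.restrict U) := by
  have hemb : Topology.IsClosedEmbedding (fun x : R4 => (x, x)) :=
    Topology.IsClosedEmbedding.of_continuous_injective_isClosedMap (by fun_prop)
      (fun x y h => (Prod.ext_iff.1 h).1) (by
        intro s hs
        have : (fun x : R4 => (x, x)) '' s = Prod.fst ⁻¹' s ∩ diagonal R4 := by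
          ext ⟨a, b⟩
          simp only [mem_image, Prod.mk.injEq, mem_inter_iff, mem_preimage, mem_diagonal_iff]
          constructor
          · rintro ⟨x, hx, rfl, rfl⟩; exact ⟨hx, rfl⟩
          · rintro ⟨h, rfl⟩; exact ⟨a, h, rfl, rfl⟩
        rw [this]
        exact (hs.preimage continuous_fst).inter isClosed_diagonal)
  exact ((hf.comp hemb.continuous).integrable_of_hasCompactSupport
    (hs.comp_isClosedEmbedding hemb)).restrict

/-- The scalar distribution `δ⁽⁴⁾(x - y)` on `U × U`, that is
`∫ ψ(x, y) δ⁽⁴⁾(x - y) dx dy = ∫_U ψ(x, x) dx`. -/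
def diagDelta (U : Opens R4) : 𝓓'(prodOpens U U, ℝ) :=
  TestFunction.mkCLM ℝ (fun ψ => ∫ x in (U : Set R4), ψ (x, x))
    (fun f g => integral_add (integrable_diag f f.continuous f.hasCompactSupport)
      (integrable_diag g g.continuous g.hasCompactSupport))
    (fun c f => integral_const_mul c fun x => f (x, x))
    (fun K hK =>
      (ContDiffMapSupportedIn.mkCLMtoNormedSpace ℝ (n := ⊤) (K := K) (F := ℝ)
        (fun f => ∫ x in (U : Set R4), f (x, x))
        (fun f g => integral_add (integrable_diag f f.continuous f.hasCompactSupport)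
          (integrable_diag g g.continuous g.hasCompactSupport))
        (fun c f => integral_const_mul c fun x => f (x, x))
        (by
          refine ⟨{0}, volume.real (Prod.fst '' (K : Set (R4 × R4))), measureReal_nonneg,
            fun f => ?_⟩
          have hL : IsCompact (Prod.fst '' (K : Set (R4 × R4))) := K.isCompact.image continuous_fst
          have hLU : Prod.fst '' (K : Set (R4 × R4)) ⊆ U := by
            rintro _ ⟨p, hp, rfl⟩
            exact (hK hp).1
          have h1 : ∫ x in (U : Set R4), f (x, x) =
              ∫ x in Prod.fst '' (K : Set (R4 × R4)), f (x, x) := by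
            refine setIntegral_eq_of_subset_of_forall_sdiff_eq_zero U.isOpen.measurableSet hLU ?_
            intro x hx
            exact f.zero_on_compl fun h => hx.2 ⟨_, h, rfl⟩
          rw [h1, mul_comm, Finset.sup_singleton]
          exact norm_setIntegral_le_of_norm_le_const hL.measure_lt_top fun x _ =>
            ContDiffMapSupportedIn.norm_apply_le_seminorm ℝ)).continuous)

theorem diagDelta_apply (U : Opens R4) (ψ : 𝓓(prodOpens U U, ℝ)) :
    diagDelta U ψ = ∫ x in (U : Set R4), ψ (x, x) := rfl

/-- The distributional `4`-form `u η` on an open subset of `R4 × R4`, for a scalar distribution `u`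
and a constant `4`-form `η`: if `α ∧ η = f dx⁰∧⋯∧dx³∧dy⁰∧⋯∧dy³` then `∫ α ∧ (u η) = u (f)`. -/
def distribMulForm {W : Opens (R4 × R4)} (u : 𝓓'(W, ℝ)) (η : (R4 × R4) [⋀^Fin 4]→L[ℝ] ℝ) :
    FormDistribution W 4 :=
  pairWith u (wedgeEval η frame)

theorem distribMulForm_apply {W : Opens (R4 × R4)} (u : 𝓓'(W, ℝ))
    (η : (R4 × R4) [⋀^Fin 4]→L[ℝ] ℝ) (α : TestForm W 4) :
    distribMulForm u η α = u (TestFunction.postcompCLM (wedgeEval η frame) α) := by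
  unfold distribMulForm
  rw [pairWith_apply]

/-- The distributional `4`-form
`Δ = ¼ ε_{abcd} δ⁽⁴⁾(x - y) dxᵃ ∧ dxᵇ ∧ dyᶜ ∧ dyᵈ` on `U × U`. -/
def Delta (U : Opens R4) : FormDistribution (prodOpens U U) 4 :=
  (1 / 4 : ℝ) • ∑ a, ∑ b, ∑ c, ∑ d, leviCivita a b c d •
    distribMulForm (diagDelta U) (covectorWedge ![dx a, dx b, dy c, dy d])

end DeltaForm

end

/-! All terms of `Delta` share the coefficient δ(x - y), so Δ is this scalar distribution times one
constant 4-form η (`diagForm`). Testing a form β against it integrates the top-degree coefficient of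
β ∧ η over the diagonal. Hence only points (x, x) matter, and there the derivative of φ⁻¹ × φ⁻¹ is A
× A, with the same A = Dφ⁻¹(x) in both factors.

Three powers of det A are compared. Pulling an 8-form back along A × A multiplies it by (det A)².
Pulling η back multiplies it by det A (`diagForm_pullCovector`): evaluated on vectors, η is a signed
sum of 4×4 determinants, all of whose rows A transforms. Since pullback is multiplicative for ∧,
cancelling one factor leaves ((A × A)^*β) ∧ η = det A · (β ∧ η)
(`wedgeEval_pullCovector_of_eq_smul`).

Integration over the diagonal supplies the Jacobian |det A| (`pairWith_diagDelta_eq`). Orientation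
preservation gives |det A| = det A, and the two sides agree. -/

namespace DeltaForm

noncomputable section

/-! ### Pullback and wedge product of covectors -/

section Forms

variable {E : Type*} [NormedAddCommGroup E] [NormedSpace ℝ E]

/-- The pullback of a `k`-covector along a linear map. -/
def pullCovector {k : ℕ} (L : E →L[ℝ] E) (α : E [⋀^Fin k]→L[ℝ] ℝ) : E [⋀^Fin k]→L[ℝ] ℝ :=
  α.compContinuousLinearMap L

theorem pullCovector_apply {k : ℕ} (L : E →L[ℝ] E) (α : E [⋀^Fin k]→L[ℝ] ℝ) (v : Fin k → E) :
    pullCovector L α v = α (L ∘ v) := rfl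

theorem Diffeo.signedPullback_eq_pullCovector [FiniteDimensional ℝ E] {V U : Opens E}
    (φ : Diffeo V U) {k : ℕ} (β : TestForm U k) {x : E} (hx : x ∈ V) (hs : φ.detSign x = 1) :
    φ.signedPullback k β x = pullCovector (fderiv ℝ φ.toHomeo x) (β (φ.toHomeo x)) := by
  rw [φ.signedPullback_apply β hx, hs, one_smul]
  rfl

/-- The identity holds shuffle by shuffle: each summand only evaluates the two forms on permuted
vectors, and applying `L` commutes with permuting. -/
theorem wedge_pullCovector {p q : ℕ} (α : E [⋀^Fin p]→L[ℝ] ℝ)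
    (η : E [⋀^Fin q]→L[ℝ] ℝ) (L : E →L[ℝ] E) :
    wedge (pullCovector L α) (pullCovector L η) =
      (wedge α η).compLinearMap (L : E →ₗ[ℝ] E) := by
  ext v
  rw [AlternatingMap.compLinearMap_apply, wedge_apply, wedge_apply]
  refine Finset.sum_congr rfl fun σ _ => ?_
  induction σ using Quotient.inductionOn' with
  | h σ => simp only [mul_summand]; rfl

/-- An alternating form of top degree is multiplied by `det L` under pullback along `L`. -/
theorem compLinearMap_eq_det_smul {ι V : Type*} [Fintype ι] [DecidableEq ι] [AddCommGroup V]
    [Module ℝ V] (e : Module.Basis ι ℝ V) (f : V [⋀^ι]→ₗ[ℝ] ℝ) (L : V →ₗ[ℝ] V) :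
    f.compLinearMap L = LinearMap.det L • f := by
  ext v
  rw [AlternatingMap.compLinearMap_apply, AlternatingMap.smul_apply, f.eq_smul_basis_det e,
    AlternatingMap.smul_apply, AlternatingMap.smul_apply]
  change _ • e.det (L ∘ v) = _
  rw [e.det_comp]
  simp only [smul_eq_mul]
  ring

/-- A basis indexed by `Fin p ⊕ Fin q` forces dimension p + q, so the wedge product has top degree.
-/
theorem wedge_pullCovector_eq_det_smul {p q : ℕ}
    (e : Module.Basis (Fin p ⊕ Fin q) ℝ E) (α : E [⋀^Fin p]→L[ℝ] ℝ) (η : E [⋀^Fin q]→L[ℝ] ℝ)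
    (L : E →L[ℝ] E) :
    wedge (pullCovector L α) (pullCovector L η) =
      L.det • wedge α η := by
  rw [wedge_pullCovector, compLinearMap_eq_det_smul e]

theorem wedge_add_right {p q : ℕ} (α : E [⋀^Fin p]→L[ℝ] ℝ) (η θ : E [⋀^Fin q]→L[ℝ] ℝ) :
    wedge α (η + θ) = wedge α η + wedge α θ := by
  ext v
  simp only [AlternatingMap.add_apply, wedge_apply, ← Finset.sum_add_distrib]
  refine Finset.sum_congr rfl fun σ _ => ?_
  induction σ using Quotient.inductionOn' with
  | h σ => simp only [mul_summand, ContinuousAlternatingMap.add_apply]; ring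

theorem wedge_smul_right {p q : ℕ} (c : ℝ) (α : E [⋀^Fin p]→L[ℝ] ℝ)
    (η : E [⋀^Fin q]→L[ℝ] ℝ) : wedge α (c • η) = c • wedge α η := by
  ext v
  simp only [AlternatingMap.smul_apply, wedge_apply, smul_eq_mul, Finset.mul_sum]
  refine Finset.sum_congr rfl fun σ _ => ?_
  induction σ using Quotient.inductionOn' with
  | h σ => simp only [mul_summand, ContinuousAlternatingMap.smul_apply, smul_eq_mul]; ring

theorem wedgeEval_apply {p q : ℕ} (η : E [⋀^Fin q]→L[ℝ] ℝ) (v : Fin p ⊕ Fin q → E)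
    (α : E [⋀^Fin p]→L[ℝ] ℝ) : wedgeEval η v α = wedge α η v := rfl

/-- Pulling back both factors of α ∧ η produces det L = c². The factor η accounts for one c, which
cancels because c ≠ 0; the other is left to α. -/
theorem wedgeEval_pullCovector_of_eq_smul {p q : ℕ}
    (e : Module.Basis (Fin p ⊕ Fin q) ℝ E) {η : E [⋀^Fin q]→L[ℝ] ℝ} {L : E →L[ℝ] E} {c : ℝ}
    (hc : c ≠ 0) (hL : L.det = c * c) (hη : pullCovector L η = c • η)
    (α : E [⋀^Fin p]→L[ℝ] ℝ) (v : Fin p ⊕ Fin q → E) :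
    wedgeEval η v (pullCovector L α) = c * wedgeEval η v α := by
  rw [wedgeEval_apply, wedgeEval_apply]
  have h := DFunLike.congr_fun (wedge_pullCovector_eq_det_smul e α η L) v
  rw [hη, wedge_smul_right, hL, AlternatingMap.smul_apply, AlternatingMap.smul_apply,
    smul_eq_mul, smul_eq_mul, mul_assoc] at h
  exact mul_left_cancel₀ hc h

theorem Diffeo.wedgeEval_signedPullback [FiniteDimensional ℝ E] {p q : ℕ}
    (e : Module.Basis (Fin p ⊕ Fin q) ℝ E) {V U : Opens E} (φ : Diffeo V U)
    {η : E [⋀^Fin q]→L[ℝ] ℝ} {L : E →L[ℝ] E} {c : ℝ} (hc : c ≠ 0) (hL : L.det = c * c)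
    (hη : pullCovector L η = c • η) (β : TestForm U p) (v : Fin p ⊕ Fin q → E) {x : E}
    (hx : x ∈ V) (hs : φ.detSign x = 1) (hφ : fderiv ℝ φ.toHomeo x = L) :
    wedgeEval η v (φ.signedPullback p β x) = c * wedgeEval η v (β (φ.toHomeo x)) := by
  rw [φ.signedPullback_eq_pullCovector β hx hs, hφ]
  exact wedgeEval_pullCovector_of_eq_smul e hc hL hη _ v

theorem wedgeEval_add {p q : ℕ} (η θ : E [⋀^Fin q]→L[ℝ] ℝ) (v : Fin p ⊕ Fin q → E) :
    wedgeEval (η + θ) v = wedgeEval η v + wedgeEval θ v := by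
  ext α
  simp only [add_apply, wedgeEval_apply, wedge_add_right, AlternatingMap.add_apply]

theorem wedgeEval_smul {p q : ℕ} (c : ℝ) (η : E [⋀^Fin q]→L[ℝ] ℝ) (v : Fin p ⊕ Fin q → E) :
    wedgeEval (c • η) v = c • wedgeEval η v := by
  ext α
  simp only [smul_apply, wedgeEval_apply, wedge_smul_right, AlternatingMap.smul_apply]

section PairWith

variable {F : Type*} [NormedAddCommGroup F] [NormedSpace ℝ F] {W : Opens E}

theorem pairWith_add (u : 𝓓'(W, ℝ)) (S T : F →L[ℝ] ℝ) :
    pairWith u (S + T) = pairWith u S + pairWith u T := by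
  ext α
  rw [add_apply, pairWith_apply, pairWith_apply, pairWith_apply, ← map_add]
  rfl

theorem pairWith_smul (u : 𝓓'(W, ℝ)) (c : ℝ) (T : F →L[ℝ] ℝ) :
    pairWith u (c • T) = c • pairWith u T := by
  ext α
  rw [smul_apply, pairWith_apply, pairWith_apply, ← map_smul]
  rfl

end PairWith

theorem covectorWedge_apply_eq_sum {k : ℕ} (ℓ : Fin k → (E →L[ℝ] ℝ)) (v : Fin k → E) :
    covectorWedge ℓ v =
      ∑ σ : Equiv.Perm (Fin k), ((Equiv.Perm.sign σ : ℤ) : ℝ) * ∏ j, ℓ j (v (σ j)) := by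
  rw [covectorWedge_apply, Matrix.det_apply']
  rfl

end Forms

/-! ### The delta form as a scalar delta times a constant form -/

/-- The map `η ↦ u η` from constant `4`-forms to distributional `4`-forms is linear. -/
def distribMulFormₗ {W : Opens (R4 × R4)} (u : 𝓓'(W, ℝ)) :
    ((R4 × R4) [⋀^Fin 4]→L[ℝ] ℝ) →ₗ[ℝ] FormDistribution W 4 where
  toFun η := distribMulForm u η
  map_add' η θ := by
    simp only [distribMulForm, wedgeEval_add, pairWith_add]
  map_smul' c η := by
    simp only [distribMulForm, wedgeEval_smul, pairWith_smul, RingHom.id_apply]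

theorem distribMulFormₗ_apply {W : Opens (R4 × R4)} (u : 𝓓'(W, ℝ))
    (η : (R4 × R4) [⋀^Fin 4]→L[ℝ] ℝ) : distribMulFormₗ u η = distribMulForm u η := rfl

/-- The constant `4`-form `¼ ε_{abcd} dxᵃ ∧ dxᵇ ∧ dyᶜ ∧ dyᵈ` on `R4 × R4`. -/
def diagForm : (R4 × R4) [⋀^Fin 4]→L[ℝ] ℝ :=
  (1 / 4 : ℝ) • ∑ a, ∑ b, ∑ c, ∑ d, leviCivita a b c d •
    covectorWedge ![dx a, dx b, dy c, dy d]

theorem Delta_eq_distribMulForm (U : Opens R4) :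
    Delta U = distribMulForm (diagDelta U) diagForm := by
  rw [← distribMulFormₗ_apply, diagForm, Delta]
  simp only [map_smul, map_sum, distribMulFormₗ_apply]

theorem Delta_eq_pairWith (U : Opens R4) :
    Delta U = pairWith (diagDelta U) (wedgeEval diagForm frame) := by
  rw [Delta_eq_distribMulForm, distribMulForm]

theorem pairWith_diagDelta {F : Type*} [NormedAddCommGroup F] [NormedSpace ℝ F] (U : Opens R4)
    (T : F →L[ℝ] ℝ) (α : 𝓓(prodOpens U U, F)) :
    pairWith (diagDelta U) T α = ∫ x in (U : Set R4), T (α (x, x)) := rfl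

/-! ### Levi-Civita contraction and the behaviour of the constant form under A × A -/

theorem sum_leviCivita_mul (r : Fin 4 → R4) :
    ∑ a, ∑ b, ∑ c, ∑ d, leviCivita a b c d * (r 0 a * r 1 b * r 2 c * r 3 d) =
      Matrix.det (Matrix.of r) := by
  have h : ∀ a b c d, leviCivita a b c d = ∑ τ : Equiv.Perm (Fin 4),
      ((Equiv.Perm.sign τ : ℤ) : ℝ) * ((if a = τ 0 then 1 else 0) * (if b = τ 1 then 1 else 0) *
        (if c = τ 2 then 1 else 0) * (if d = τ 3 then 1 else 0)) := by
    intro a b c d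
    -- Transposing makes the Leibniz product run over entries (i, τ i), so that the i-th factor
    -- tests whether the i-th index equals τ i.
    rw [leviCivita, ← Matrix.det_transpose, Matrix.det_apply']
    refine Finset.sum_congr rfl fun τ _ => ?_
    rw [Fin.prod_univ_four]
    rfl
  rw [← Matrix.det_transpose, Matrix.det_apply']
  simp only [h, Finset.sum_mul]
  -- Fixing both index types lets the exchange go one way only: the permutation sum moves outermost
  -- and the rewriting stops.
  simp only [Finset.sum_comm (s := (Finset.univ : Finset (Fin 4)))
    (t := (Finset.univ : Finset (Equiv.Perm (Fin 4))))]
  refine Finset.sum_congr rfl fun τ _ => ?_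
  rw [Fin.prod_univ_four]
  simp [mul_assoc]

/-- For each permutation σ in the expansion of the covector wedge, contraction with ε assembles two
x-components and two y-components into the rows of a single determinant. In this form the action of
A × A is visible, since A hits every row alike. -/
theorem diagForm_apply (v : Fin 4 → R4 × R4) :
    diagForm v = (1 / 4 : ℝ) * ∑ σ : Equiv.Perm (Fin 4), ((Equiv.Perm.sign σ : ℤ) : ℝ) *
      Matrix.det (Matrix.of ![(v (σ 0)).1, (v (σ 1)).1, (v (σ 2)).2, (v (σ 3)).2]) := by
  simp only [diagForm, ContinuousAlternatingMap.smul_apply, ContinuousAlternatingMap.sum_apply,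
    smul_eq_mul, covectorWedge_apply_eq_sum, Finset.mul_sum]
  simp only [Finset.sum_comm (s := (Finset.univ : Finset (Fin 4)))
    (t := (Finset.univ : Finset (Equiv.Perm (Fin 4))))]
  refine Finset.sum_congr rfl fun σ _ => ?_
  rw [← sum_leviCivita_mul]
  simp only [Finset.mul_sum, Fin.prod_univ_four]
  refine Finset.sum_congr rfl fun a _ => Finset.sum_congr rfl fun b _ =>
    Finset.sum_congr rfl fun c _ => Finset.sum_congr rfl fun d _ => ?_
  change (1 / 4 : ℝ) * (leviCivita a b c d * (((Equiv.Perm.sign σ : ℤ) : ℝ) *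
    ((v (σ 0)).1 a * (v (σ 1)).1 b * (v (σ 2)).2 c * (v (σ 3)).2 d))) =
    (1 / 4 : ℝ) * (((Equiv.Perm.sign σ : ℤ) : ℝ) * (leviCivita a b c d *
    ((v (σ 0)).1 a * (v (σ 1)).1 b * (v (σ 2)).2 c * (v (σ 3)).2 d)))
  ring

/-- The determinant relative to the standard basis is the determinant of the matrix of rows, so this
is multiplicativity of the basis determinant. -/
theorem det_of_map_rows (A : R4 →ₗ[ℝ] R4) (r₀ r₁ r₂ r₃ : R4) :
    Matrix.det (Matrix.of ![A r₀, A r₁, A r₂, A r₃]) =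
      LinearMap.det A * Matrix.det (Matrix.of ![r₀, r₁, r₂, r₃]) := by
  have h := (Pi.basisFun ℝ (Fin 4)).det_comp A ![r₀, r₁, r₂, r₃]
  rw [Pi.basisFun_det] at h
  have h' : A ∘ ![r₀, r₁, r₂, r₃] = ![A r₀, A r₁, A r₂, A r₃] := by
    funext i
    fin_cases i <;> rfl
  rw [h'] at h
  have hof : ∀ r : Fin 4 → R4, Matrix.det (Matrix.of r) = Matrix.detRowAlternating r :=
    fun _ => rfl
  rw [hof, hof]
  exact h

/-- The diagonal form is multiplied by `det A` under pullback along `A × A`. -/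
theorem diagForm_pullCovector (A : R4 →L[ℝ] R4) :
    pullCovector (A.prodMap A) diagForm = A.det • diagForm := by
  ext v
  rw [pullCovector_apply,
    ContinuousAlternatingMap.smul_apply, diagForm_apply, diagForm_apply, smul_eq_mul,
    mul_left_comm A.det, Finset.mul_sum _ _ A.det]
  congr 1
  refine Finset.sum_congr rfl fun σ _ => ?_
  rw [mul_left_comm A.det]
  congr 1
  exact det_of_map_rows (A : R4 →ₗ[ℝ] R4) _ _ _ _

/-! ### Jacobians on the diagonal and change of variables -/

theorem det_prodMap_self (A : R4 →L[ℝ] R4) : (A.prodMap A).det = A.det * A.det :=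
  LinearMap.det_prodMap (A : R4 →ₗ[ℝ] R4) (A : R4 →ₗ[ℝ] R4)

theorem Diffeo.fderiv_prod_self {V U : Opens R4} (φ : Diffeo V U) {x : R4} (hx : x ∈ V) :
    fderiv ℝ (φ.prod φ).toHomeo (x, x) =
      (fderiv ℝ φ.toHomeo x).prodMap (fderiv ℝ φ.toHomeo x) :=
  (HasFDerivAt.prodMap (p := (x, x)) (φ.differentiableAt hx).hasFDerivAt
    (φ.differentiableAt hx).hasFDerivAt).fderiv

/-- The Jacobian determinant of φ × φ at (x, x) is a nonzero square, hence positive whether or not φ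
preserves orientation. The sign in the signed pullback therefore disappears on the diagonal. -/
theorem Diffeo.detSign_prod_self {V U : Opens R4} (φ : Diffeo V U) {x : R4} (hx : x ∈ V) :
    (φ.prod φ).detSign (x, x) = 1 := by
  rw [Diffeo.detSign, φ.fderiv_prod_self hx, det_prodMap_self,
    sign_pos (mul_self_pos.2 (φ.det_ne_zero hx))]
  rfl

theorem Diffeo.image_eq {V U : Opens R4} (φ : Diffeo V U) :
    φ.toHomeo '' (V : Set R4) = U := by
  rw [← φ.source_eq, φ.toHomeo.image_source_eq_target, φ.target_eq]

theorem Diffeo.setIntegral_eq {V U : Opens R4} (φ : Diffeo V U) (g : R4 → ℝ) :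
    ∫ x in (U : Set R4), g x =
      ∫ x in (V : Set R4), |(fderiv ℝ φ.toHomeo x).det| * g (φ.toHomeo x) := by
  have hinj : InjOn φ.toHomeo (V : Set R4) := by
    rw [← φ.source_eq]
    exact φ.toHomeo.injOn
  rw [← φ.image_eq]
  exact integral_image_eq_integral_abs_det_fderiv_smul volume V.isOpen.measurableSet
    (fun x hx => (φ.differentiableAt hx).hasFDerivAt.hasFDerivWithinAt) hinj g

/-- By the chain rule the Jacobian determinants of φ and φ⁻¹ at corresponding points have product 1.
-/
theorem Diffeo.OrientationPreserving.symm {V U : Opens R4} {φ : Diffeo V U}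
    (hφ : φ.OrientationPreserving) : φ.symm.OrientationPreserving := by
  intro y hy
  have hx : φ.symm.toHomeo y ∈ V := φ.symm.mapsTo hy
  have h1 : HasFDerivAt (φ.toHomeo ∘ φ.symm.toHomeo)
      ((fderiv ℝ φ.toHomeo (φ.symm.toHomeo y)).comp (fderiv ℝ φ.symm.toHomeo y)) y :=
    (φ.differentiableAt hx).hasFDerivAt.comp y (φ.symm.differentiableAt hy).hasFDerivAt
  have h2 : HasFDerivAt (φ.toHomeo ∘ φ.symm.toHomeo) (ContinuousLinearMap.id ℝ R4) y := by
    refine (hasFDerivAt_id y).congr_of_eventuallyEq ?_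
    filter_upwards [U.isOpen.mem_nhds hy] with z hz using φ.symm.left_inv hz
  have h3 := congrArg ContinuousLinearMap.det (h1.unique h2)
  have h4 : (fderiv ℝ φ.toHomeo (φ.symm.toHomeo y)).det * (fderiv ℝ φ.symm.toHomeo y).det = 1 :=
    (LinearMap.det_comp _ _).symm.trans (h3.trans LinearMap.det_id)
  exact pos_of_mul_pos_right (h4 ▸ one_pos) (hφ _ hx).le

/-- Change of variables for the diagonal delta distribution. -/
theorem pairWith_diagDelta_eq {F : Type*} [NormedAddCommGroup F] [NormedSpace ℝ F]
    {V U : Opens R4} (φ : Diffeo V U) (T : F →L[ℝ] ℝ) (α : 𝓓(prodOpens V V, F))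
    (β : 𝓓(prodOpens U U, F))
    (h : ∀ x ∈ V, T (α (x, x)) =
      |(fderiv ℝ φ.toHomeo x).det| * T (β (φ.toHomeo x, φ.toHomeo x))) :
    pairWith (diagDelta V) T α = pairWith (diagDelta U) T β := by
  rw [pairWith_diagDelta, pairWith_diagDelta, φ.setIntegral_eq]
  exact setIntegral_congr_fun V.isOpen.measurableSet h

end

end DeltaForm

theorem mainTheorem6 (Mhat M : TopologicalSpace.Opens DeltaForm.R4)
    (φ : DeltaForm.Diffeo Mhat M) (hφ : φ.OrientationPreserving) :
    (φ.prod φ).pullback (DeltaForm.Delta M) = DeltaForm.Delta Mhat := by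
  ext β
  rw [DeltaForm.Diffeo.pullback_apply, DeltaForm.Delta_eq_pairWith,
    DeltaForm.Delta_eq_pairWith]
  -- Test forms are carried from `Mhat` to `M` by pulling back along φ⁻¹, so the substitution uses
  -- φ⁻¹ and x ranges over `M`.
  refine DeltaForm.pairWith_diagDelta_eq φ.symm _ _ _ fun x hx => ?_
  -- Orientation enters here: the measure contributes |det A|, the algebra below contributes det A.
  rw [abs_of_pos (hφ.symm x hx)]
  have h := (φ.symm.prod φ.symm).wedgeEval_signedPullback
    ((Pi.basisFun ℝ (Fin 4)).prod (Pi.basisFun ℝ (Fin 4))) (φ.symm.det_ne_zero hx)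
    (DeltaForm.det_prodMap_self _) (DeltaForm.diagForm_pullCovector _) β DeltaForm.frame
    (x := (x, x)) ⟨hx, hx⟩ (φ.symm.detSign_prod_self hx) (φ.symm.fderiv_prod_self hx)
  generalize (fderiv ℝ φ.symm.toHomeo x).det = c at h ⊢
  generalize DeltaForm.wedgeEval DeltaForm.diagForm DeltaForm.frame = T at h ⊢
  -- The two sides still differ by (φ × φ)⁻¹ versus φ⁻¹ × φ⁻¹, which agree definitionally.
  exact h
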